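/- Throughout, algebras are finite-dimensional over $\mathbb{C}$. A (right) Leibniz algebra is a vector space $L$ with a bilinear bracket satisfying $[[x,y],z]=[[x,z],y]+[x,[y,z]]$. A linear map $P:L\to L$ is a pre-derivation if $P([[x,y],z])=[[P(x),y],z]+[[x,P(y)],z]+[[x,y],P(z)]$ for all $x,y,z\in L$, and $L$ is strongly nilpotent if every pre-derivation of $L$ is nilpotent. For $n\ge 3$, an $n$-dimensional Leibniz algebra belongs to the family $F_1(\alpha_4,\dots,\alpha_n,\theta)$ if it has a basis $e_1,\dots,e_n$ with \[ [e_1,e_1]=e_3,\qquad [e_i,e_1]=e_{i+1}\ (2\le i\le n-1),\qquad [e_1,e_2]=\sum_{t=4}^{n-1}\alpha_te_t+\theta e_n,\qquad [e_j,e_2]=\sum_{t=j+2}^{n}\alpha_{t-j+2}e_t\ (2\le j\le n-2), \] all other products of basis vectors being zero. Put $C^p_m=\frac{1}{(p-1)m+1}\binom{pm}{m}$. **Theorem.** Let $n\ge 3$ be odd and let $L$ be a filiform Leibniz algebra from the family $F_1(\alpha_4,\dots,\alpha_n,\theta)$. Then $L$ is not strongly nilpotent if and only if at least one of the following holds: 1.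 $\alpha_4\neq 0$ and $\alpha_k=(-1)^kC^2_{k-3}\,\alpha_4^{k-3}$ for $5\le k\le n-2$; 2. for some $s$ with $3\le s\le\frac{n-3}{2}$: $\alpha_{(2s-3)t+3}=(-1)^{t+1}C^{2s-2}_t\,\alpha_{2s}^t$ for $1\le t\le\lfloor\frac{n-5}{2s-3}\rfloor$, and $\alpha_j=0$ for every $4\le j\le n-2$ that is not of the form $(2s-3)t+3$ with such a $t$; 3. $\alpha_{2i}=0$ for $2\le i\le\frac{n-1}{2}$; 4. for some $s$ with $2\le s\le\frac{n-3}{2}$: $\alpha_{(2s-2)t+3}=(-1)^{t+1}C^{2s-1}_t\,\alpha_{2s+1}^t$ for $1\le t\le\lfloor\frac{n-5}{2s-2}\rfloor$, and $\alpha_j=0$ for every $4\le j\le n-2$ that is not of the form $(2s-2)t+3$ with such a $t$. (The parameters not mentioned in a case are arbitrary; $\alpha_{2s}$ in case 2 and $\alpha_{2s+1}$ in case 4 are allowed to be zero.) -/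

import Mathlib

/-- The right Leibniz identity `[[x, y], z] = [[x, z], y] + [x, [y, z]]` for a bilinear bracket
on a complex vector space. -/
def IsLeibnizBracket {L : Type*} [AddCommGroup L] [Module ℂ L] (br : L →ₗ[ℂ] L →ₗ[ℂ] L) : Prop :=
  ∀ x y z : L, br (br x y) z = br (br x z) y + br x (br y z)

/-- `P` is a pre-derivation:
`P [[x, y], z] = [[P x, y], z] + [[x, P y], z] + [[x, y], P z]`. -/
def IsPreDerivation {L : Type*} [AddCommGroup L] [Module ℂ L] (br : L →ₗ[ℂ] L →ₗ[ℂ] L)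
    (P : L →ₗ[ℂ] L) : Prop :=
  ∀ x y z : L, P (br (br x y) z) = br (br (P x) y) z + br (br x (P y)) z + br (br x y) (P z)

/-- A Leibniz algebra is strongly nilpotent if every pre-derivation of it is a nilpotent
linear map. -/
def IsStronglyNilpotent {L : Type*} [AddCommGroup L] [Module ℂ L]
    (br : L →ₗ[ℂ] L →ₗ[ℂ] L) : Prop :=
  ∀ P : Module.End ℂ L, IsPreDerivation br P → IsNilpotent P

/-- The basis vectors with indices `1, …, n` as in `e₁, …, eₙ` (and `0` for any other index). -/
noncomputable def basisVec {L : Type*} [AddCommGroup L] [Module ℂ L] {n : ℕ}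
    (b : Module.Basis (Fin n) ℂ L) (i : ℕ) : L :=
  if h : 1 ≤ i ∧ i ≤ n then b ⟨i - 1, by omega⟩ else 0

/-- In the basis `e₁, …, eₙ` the bracket has the multiplication table of the algebra
`F₁(α₄, …, αₙ, θ)`. Only the values `α 4, …, α n` of `α` are used. -/
structure IsFirstFamily {L : Type*} [AddCommGroup L] [Module ℂ L] {n : ℕ}
    (br : L →ₗ[ℂ] L →ₗ[ℂ] L) (b : Module.Basis (Fin n) ℂ L) (α : ℕ → ℂ) (θ : ℂ) : Prop where
  one_one : br (basisVec b 1) (basisVec b 1) = basisVec b 3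
  right_one : ∀ i : ℕ, 2 ≤ i → i + 1 ≤ n →
    br (basisVec b i) (basisVec b 1) = basisVec b (i + 1)
  one_two : br (basisVec b 1) (basisVec b 2) =
    (∑ t ∈ Finset.Icc 4 (n - 1), α t • basisVec b t) + θ • basisVec b n
  right_two : ∀ j : ℕ, 2 ≤ j → j + 2 ≤ n →
    br (basisVec b j) (basisVec b 2) =
      ∑ t ∈ Finset.Icc (j + 2) n, α (t - j + 2) • basisVec b t
  -- all the remaining products of basis vectors vanish
  last_one : br (basisVec b n) (basisVec b 1) = 0
  last_two : ∀ j : ℕ, 2 ≤ j → n < j + 2 → j ≤ n → br (basisVec b j) (basisVec b 2) = 0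
  right_ge_three : ∀ i j : ℕ, 1 ≤ i → i ≤ n → 3 ≤ j → j ≤ n →
    br (basisVec b i) (basisVec b j) = 0

/-- The number `C^p_m = 1 / ((p - 1) m + 1) * binom (p m) m`, the `m`-th of the
`p`-th Catalan numbers. -/
noncomputable def catalanNumber (p m : ℕ) : ℂ :=
  1 / (((p : ℂ) - 1) * (m : ℂ) + 1) * ((p * m).choose m : ℂ)

/-!
Identify `e_{k + 2}` with `x ^ k`, so that `e₂, …, eₙ` span `M = ℂ[[x]] / x ^ (n - 1)`, and put
`g = ∑_{k ≥ 1} α_{k + 3} x ^ k`. Right multiplication by `e₁` acts on `M` as `x`, right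
multiplication by `e₂` acts as `x g`, and a triple product whose leftmost factor is `e₁ - e₂`
vanishes. Hence `[[u, y], z] = m(u) ℓ(y) ℓ(z)` with `m(u)` the series of `u` (`e₁` and `e₂` both
give `1`) and `ℓ(y) = y₁ x + y₂ x g` (`triple_bracket`); in particular `θ` plays no role.

A pre-derivation `P` induces an operator `D` on `M`. Let `a` and `b` be the coefficients of `e₁`
and `e₂` in `P e₁`. Since `x ^ 2 = ℓ(e₁) ^ 2`, the operator `D - D 1 - (a + b g) x d/dx` commutes
with multiplication by `x ^ 2`, so it factors through the projection to the part of odd degree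
(`X_mul_derivationDefect`). Inserting this into the relation for `ℓ(e₁) ℓ(e₂) = x ^ 2 g` and
comparing its values at `1` and at `x` gives the weight equation `(a + b g) x g' = b g - b g ^ 2`
modulo `x ^ (n - 4)` (`weight_relations`). If the odd part of `g` is nonzero modulo `x ^ (n - 3)`
and `a = b = 0`, then `P` raises the order in `x` and is nilpotent
(`IsPreDerivation.exists_weightDefect`). Conversely, a solution with `a ≠ 0`, or the vanishing of
the odd part of `g`, gives an explicit pre-derivation with a nonzero eigenvalue (`weightMap`).

So the algebra is not strongly nilpotent exactly when the odd part of `g` vanishes modulo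
`x ^ (n - 3)`, which is condition 3, or the weight equation has a solution `(a, b) ≠ (0, 0)`. If
`g` has order `r`, its lowest term forces `b = a r`, and the equation becomes a recursion for the
coefficients. Its solutions are the series `g = c x ^ r (1 - g) ^ (r + 1)`, whose coefficients are
the `(r + 1)`-st Catalan numbers up to sign and powers of `c`; that these satisfy the recursion is
a case of the Rothe–Hagen identity (`sum_catalanNumber_mul`). The values `r = 1`, `r = 2 s - 3`
and `r = 2 s - 2` are the conditions 1, 2 and 4.
-/

/-! ### Catalan numbers and the Rothe–Hagen identity -/

/-- The coefficient of `z ^ m` in `B ^ x`, where `B = 1 + z * B ^ p` is the generating series of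
the `p`-th Catalan numbers, defined by the recursion that expresses
`B ^ (x + 1) = B ^ x + z * B ^ (x + p)`. -/
def catalanPower (p : ℕ) : ℕ → ℕ → ℕ
  | 0, _ => 1
  | _ + 1, 0 => 0
  | m + 1, x + 1 => catalanPower p (m + 1) x + catalanPower p m (x + p)
termination_by m x => (m, x)

/-- The Rothe–Hagen identity; both sides satisfy the same recursion in `x` and `m` by Pascal's
rule. -/
theorem sum_catalanPower_mul_choose (p y m x : ℕ) :
    ∑ ij ∈ Finset.HasAntidiagonal.antidiagonal m,
      catalanPower p ij.1 x * (y + p * ij.2).choose ij.2 =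
      (x + y + p * m).choose m := by
  induction m generalizing x with
  | zero => simp [catalanPower]
  | succ m ihm =>
    induction x with
    | zero =>
      rw [Finset.Nat.sum_antidiagonal_succ]
      simp [catalanPower]
    | succ x ihx =>
      rw [Finset.Nat.sum_antidiagonal_succ] at ihx ⊢
      simp only [catalanPower, add_mul, Finset.sum_add_distrib] at ihx ⊢
      rw [ihm (x + p), ← add_assoc, ihx,
        show x + 1 + y + p * (m + 1) = (x + y + p * (m + 1)) + 1 by ring, Nat.choose_succ_succ,
        show x + p + y + p * m = x + y + p * (m + 1) by ring]
      ring

/-- The closed form `x / (x + p m) * binom (x + p m) m` of the coefficients of `B ^ x`. -/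
theorem catalanPower_mul (p : ℕ) (hp : 1 ≤ p) (m x : ℕ) :
    catalanPower p m x * (x + p * m) = x * (x + p * m).choose m := by
  induction m generalizing x with
  | zero => simp [catalanPower]
  | succ m ihm =>
    induction x with
    | zero => simp [catalanPower]
    | succ x ihx =>
      have h1 := ihm (x + p)
      have h2 := Nat.choose_succ_right_eq (x + p * (m + 1)) m
      rw [show x + p + p * m = x + p * (m + 1) by ring] at h1
      have hN : 0 < x + p * (m + 1) := by positivity
      have hm : m ≤ x + p * (m + 1) := by nlinarith
      rw [show x + 1 + p * (m + 1) = (x + p * (m + 1)) + 1 by ring, Nat.choose_succ_succ,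
        catalanPower]
      have hNp : x + p + p * m = x + p * (m + 1) := by ring
      generalize hNN : x + p * (m + 1) = N at *
      zify [hm] at h1 h2 ihx hNp ⊢
      have hN' : (N : ℤ) * (m + 1) ≠ 0 := by positivity
      apply mul_left_cancel₀ hN'
      linear_combination (N + 1) * (m + 1) * (h1 + ihx) + (x - N) * h2
        + (N+1) * (N.choose m) * hNp

theorem catalanPower_one (p : ℕ) (hp : 1 ≤ p) (m : ℕ) :
    (catalanPower p m 1 : ℂ) = catalanNumber p m := by
  have h1 := catalanPower_mul p hp m 1
  have h2 := Nat.choose_mul_succ_eq (p * m) m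
  have hm : m ≤ p * m := Nat.le_mul_of_pos_left m hp
  rw [show p * m + 1 - m = (p - 1) * m + 1 by rw [Nat.sub_mul]; omega] at h2
  have h3 : ((p : ℂ) - 1) * m + 1 ≠ 0 := by
    rw [← Nat.cast_one, ← Nat.cast_sub hp]; norm_cast
  have h4 : (1 + p * m : ℂ) ≠ 0 := by
    norm_cast; omega
  unfold catalanNumber
  rw [one_div_mul_eq_div, eq_div_iff h3]
  apply mul_left_cancel₀ h4
  rw [add_comm 1 (p * m)] at h1
  zify [hp] at h1 h2
  have h1' : (catalanPower p m 1 : ℂ) * (p * m + 1) = (p * m + 1).choose m := by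
    exact_mod_cast h1.trans (one_mul _)
  have h2' : ((p * m).choose m : ℂ) * (p * m + 1) = (p * m + 1).choose m * ((p - 1) * m + 1) := by
    exact_mod_cast h2
  linear_combination ((p - 1) * m + 1) * h1' - h2'

theorem catalanNumber_zero (p : ℕ) : catalanNumber p 0 = 1 := by simp [catalanNumber]

theorem catalanNumber_one (p : ℕ) (hp : 1 ≤ p) : catalanNumber p 1 = 1 := by
  have : (p : ℂ) ≠ 0 := by norm_cast; omega
  simp [catalanNumber, this]

/-- The convolution recursion of the Catalan numbers: with `w j = (p - 1) * j + 1`, the numbers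
`w j * C j` are plain binomial coefficients, so this is a case of the Rothe–Hagen identity. -/
theorem sum_catalanNumber_mul (p : ℕ) (hp : 1 ≤ p) (m : ℕ) :
    ∑ ij ∈ Finset.HasAntidiagonal.antidiagonal m,
      catalanNumber p ij.1 * ((((p : ℂ) - 1) * ij.2 + 1) * catalanNumber p ij.2) =
      (p * m + 1) * catalanNumber p m := by
  have h := sum_catalanPower_mul_choose p 0 m 1
  have h1 := catalanPower_mul p hp m 1
  rw [add_zero] at h
  rw [one_mul, ← h] at h1
  rw [← catalanPower_one p hp m]
  have h2 : ((catalanPower p m 1 * (1 + p * m) : ℕ) : ℂ) = _ := congrArg _ h1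
  push_cast at h2
  rw [add_comm (p * m : ℂ), mul_comm, h2]
  refine Finset.sum_congr rfl fun ij _ => ?_
  rw [catalanPower_one p hp, zero_add]
  have h3 : ((p : ℂ) - 1) * ij.2 + 1 ≠ 0 := by
    rw [← Nat.cast_one, ← Nat.cast_sub hp]; norm_cast
  congr 1
  unfold catalanNumber
  field_simp

/-! ### The weight equation and its solutions -/

section
open PowerSeries

/-- The defect of the weight equation `(a + b g) x g' = b g - b g ^ 2`, which says that the
derivation `(a + b g) x d/dx` multiplies `x g` by `a + b`. -/
noncomputable def weightDefect (a b : ℂ) (g : ℂ⟦X⟧) : ℂ⟦X⟧ :=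
  (C a + C b * g) * (X * d⁄dX ℂ g) - C b * g + C b * g ^ 2

theorem coeff_X_mul_derivative (g : ℂ⟦X⟧) (k : ℕ) : coeff k (X * d⁄dX ℂ g) = k * coeff k g := by
  cases k with
  | zero => simp
  | succ k => rw [coeff_succ_X_mul, coeff_derivative]; push_cast; ring

theorem coeff_weightDefect (a b : ℂ) (g : ℂ⟦X⟧) (k : ℕ) :
    coeff k (weightDefect a b g) = (a * k - b) * coeff k g +
      b * ∑ ij ∈ Finset.HasAntidiagonal.antidiagonal k,
        coeff ij.1 g * ((ij.2 + 1) * coeff ij.2 g) := by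
  have h : weightDefect a b g =
      C a * (X * d⁄dX ℂ g) - C b * g + C b * (g * (X * d⁄dX ℂ g + g)) := by
    unfold weightDefect; ring
  rw [h, map_add, map_sub, coeff_C_mul, coeff_C_mul, coeff_C_mul,
    coeff_X_mul_derivative, coeff_mul]
  simp only [map_add, coeff_X_mul_derivative]
  have : ∀ j : ℕ, (j : ℂ) * coeff j g + coeff j g = (j + 1) * coeff j g := fun j => by ring
  simp only [this]
  ring

/-- The series `∑ (-1) ^ (t + 1) * C ^ (r + 1)_t * c ^ t * x ^ (r t)` over `t ≥ 1`, that is, the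
solution `y` of `y = c * x ^ r * (1 - y) ^ (r + 1)`. -/
noncomputable def fussCatalanSeries (r : ℕ) (c : ℂ) : ℂ⟦X⟧ :=
  mk fun k => if r ∣ k ∧ k ≠ 0 then
    (-1) ^ (k / r + 1) * catalanNumber (r + 1) (k / r) * c ^ (k / r) else 0

theorem coeff_fussCatalanSeries_mul {r : ℕ} (hr : 1 ≤ r) (c : ℂ) (t : ℕ) :
    coeff (r * t) (fussCatalanSeries r c) =
      (-1) ^ (t + 1) * catalanNumber (r + 1) t * c ^ t + if t = 0 then 1 else 0 := by
  have h1 : r * t / r = t := Nat.mul_div_cancel_left t hr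
  have h2 : r ≠ 0 := by omega
  rw [fussCatalanSeries, coeff_mk, h1]
  by_cases ht : t = 0 <;> simp [ht, h2, catalanNumber_zero]

theorem coeff_fussCatalanSeries_of_not_dvd {r k : ℕ} (c : ℂ) (h : ¬ r ∣ k) :
    coeff k (fussCatalanSeries r c) = 0 := by
  simp [fussCatalanSeries, h]

theorem coeff_fussCatalanSeries_self {r : ℕ} (hr : 1 ≤ r) (c : ℂ) :
    coeff r (fussCatalanSeries r c) = c := by
  have := coeff_fussCatalanSeries_mul hr c 1
  simpa [catalanNumber_one] using this

theorem coeff_zero_fussCatalanSeries (r : ℕ) (c : ℂ) : coeff 0 (fussCatalanSeries r c) = 0 := by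
  simp [fussCatalanSeries]

theorem sum_antidiagonal_mul_of_support {r : ℕ} (hr : 1 ≤ r) (T : ℕ) (F : ℕ → ℕ → ℂ)
    (hF : ∀ i j, ¬ r ∣ i → F i j = 0) :
    ∑ ij ∈ Finset.HasAntidiagonal.antidiagonal (r * T), F ij.1 ij.2 =
      ∑ ij ∈ Finset.HasAntidiagonal.antidiagonal T, F (r * ij.1) (r * ij.2) := by
  symm
  refine Finset.sum_of_injOn (fun ij => (r * ij.1, r * ij.2)) ?_ ?_ ?_ ?_
  · rintro ⟨i, j⟩ - ⟨i', j'⟩ - h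
    have h2 : r ≠ 0 := by omega
    simpa [h2] using h
  · rintro ⟨i, j⟩ h
    simp only [Finset.mem_coe, Finset.HasAntidiagonal.mem_antidiagonal] at h ⊢
    rw [← mul_add, h]
  · rintro ⟨i, j⟩ h hn
    apply hF
    rintro ⟨i', rfl⟩
    simp only [Finset.HasAntidiagonal.mem_antidiagonal] at h
    have hj : r ∣ j := (Nat.dvd_add_right (Dvd.intro i' rfl)).1 (h ▸ Dvd.intro T rfl)
    obtain ⟨j', rfl⟩ := hj
    apply hn
    refine ⟨(i', j'), ?_, rfl⟩
    simp only [Finset.mem_coe, Finset.HasAntidiagonal.mem_antidiagonal]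
    rw [← mul_add] at h
    exact Nat.eq_of_mul_eq_mul_left hr h
  · intros; rfl

theorem weightDefect_fussCatalanSeries {r : ℕ} (hr : 1 ≤ r) (c : ℂ) :
    weightDefect 1 r (fussCatalanSeries r c) = 0 := by
  ext k
  rw [coeff_weightDefect, map_zero]
  by_cases hk : r ∣ k
  · obtain ⟨T, rfl⟩ := hk
    rw [sum_antidiagonal_mul_of_support hr T
      (fun i j => coeff i (fussCatalanSeries r c) * ((j + 1) * coeff j (fussCatalanSeries r c)))
      (fun i j h => by rw [coeff_fussCatalanSeries_of_not_dvd c h, zero_mul])]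
    simp only [coeff_fussCatalanSeries_mul hr]
    -- only the indices divisible by `r` contribute; the two end terms of the convolution, where the
    -- coefficient of `x ^ 0` is `0` and not `-C_0`, are split off
    have key := sum_catalanNumber_mul (r + 1) (by omega) T
    push_cast at key
    have hx : ∑ ij ∈ Finset.HasAntidiagonal.antidiagonal T,
        ((-1) ^ (ij.1 + 1) * catalanNumber (r + 1) ij.1 * c ^ ij.1) *
          ((((r * ij.2 : ℕ) : ℂ) + 1) *
            ((-1) ^ (ij.2 + 1) * catalanNumber (r + 1) ij.2 * c ^ ij.2)) =
        (-1) ^ T * c ^ T * (((r + 1) * T + 1) * catalanNumber (r + 1) T) := by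
      rw [← key, Finset.mul_sum]
      refine Finset.sum_congr rfl fun ij hij => ?_
      rw [Finset.HasAntidiagonal.mem_antidiagonal] at hij
      rw [← hij]
      push_cast
      ring
    have hl : ∀ F : ℕ → ℂ, ∑ ij ∈ Finset.HasAntidiagonal.antidiagonal T,
        (if ij.1 = 0 then 1 else 0) * F ij.2 = F T := by
      intro F
      rw [Finset.sum_eq_single (0, T)]
      · simp
      · rintro ⟨i, j⟩ h hne
        rw [Finset.HasAntidiagonal.mem_antidiagonal] at h
        have : i ≠ 0 := by rintro rfl; apply hne; simpa using h
        simp [this]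
      · simp
    have hr' : ∀ F : ℕ → ℂ, ∑ ij ∈ Finset.HasAntidiagonal.antidiagonal T,
        F ij.1 * ((((r * ij.2 : ℕ) : ℂ) + 1) * (if ij.2 = 0 then 1 else 0)) = F T := by
      intro F
      rw [Finset.sum_eq_single (T, 0)]
      · simp
      · rintro ⟨i, j⟩ h hne
        rw [Finset.HasAntidiagonal.mem_antidiagonal] at h
        have : j ≠ 0 := by rintro rfl; apply hne; simpa using h
        simp [this]
      · simp
    simp only [add_mul _ (ite _ _ _), hl fun j => (((r * j : ℕ) : ℂ) + 1) *
      ((-1) ^ (j + 1) * catalanNumber (r + 1) j * c ^ j + if j = 0 then 1 else 0),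
      Finset.sum_add_distrib]
    simp only [mul_add _ _ (ite _ _ _), mul_add _ _ (_ * ite _ _ _), Finset.sum_add_distrib]
    rw [hx, hr' fun i => (-1) ^ (i + 1) * catalanNumber (r + 1) i * c ^ i]
    by_cases hT : T = 0
    · subst hT; simp [catalanNumber_zero]
    · simp only [hT, if_false]
      push_cast
      ring
  · rw [coeff_fussCatalanSeries_of_not_dvd c hk, Finset.sum_eq_zero, mul_zero, mul_zero, zero_add]
    rintro ⟨i, j⟩ hij
    rw [Finset.HasAntidiagonal.mem_antidiagonal] at hij
    by_cases hi : r ∣ i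
    · have hj : ¬ r ∣ j := fun hj => hk (hij ▸ dvd_add hi hj)
      simp [coeff_fussCatalanSeries_of_not_dvd c hj]
    · simp [coeff_fussCatalanSeries_of_not_dvd c hi]

/-- Below degree `N`, a solution of the weight equation that starts in degree `r` is determined by
its leading coefficient. -/
theorem coeff_eq_fussCatalanSeries_of_dvd_weightDefect {N r : ℕ} (hr : 1 ≤ r) {a : ℂ} (ha : a ≠ 0)
    {g : ℂ⟦X⟧} (hg : ∀ i < r, coeff i g = 0) (hE : X ^ N ∣ weightDefect a (a * r) g) :
    ∀ k < N, coeff k g = coeff k (fussCatalanSeries r (coeff r g)) := by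
  rw [X_pow_dvd_iff] at hE
  intro k
  induction k using Nat.strong_induction_on with
  | _ k ih =>
    intro hk
    rcases lt_trichotomy k r with h | rfl | h
    · rw [hg k h]
      rcases Nat.eq_zero_or_pos k with rfl | h0
      · rw [coeff_zero_fussCatalanSeries]
      · rw [coeff_fussCatalanSeries_of_not_dvd _ (Nat.not_dvd_of_pos_of_lt h0 h)]
    · rw [coeff_fussCatalanSeries_self hr]
    · have h1 := hE k hk
      have h2 := congrArg (coeff k) (weightDefect_fussCatalanSeries hr (coeff r g))
      rw [coeff_weightDefect] at h1 h2
      rw [Finset.sum_congr rfl (g := fun ij => coeff ij.1 (fussCatalanSeries r (coeff r g)) *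
        ((ij.2 + 1) * coeff ij.2 (fussCatalanSeries r (coeff r g))))] at h1
      · have h3 : a * (k - r : ℂ) ≠ 0 := by
          refine mul_ne_zero ha (sub_ne_zero.2 ?_)
          norm_cast; omega
        apply mul_left_cancel₀ h3
        rw [map_zero] at h2
        linear_combination h1 - a * h2
      · rintro ⟨i, j⟩ hij
        rw [Finset.HasAntidiagonal.mem_antidiagonal] at hij
        simp only at hij ⊢
        rcases Nat.eq_zero_or_pos i with rfl | hi
        · rw [hg 0 (by omega), coeff_zero_fussCatalanSeries, zero_mul, zero_mul]
        rcases Nat.eq_zero_or_pos j with rfl | hj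
        · rw [hg 0 (by omega), coeff_zero_fussCatalanSeries, mul_zero, mul_zero, mul_zero]
        rw [ih i (by omega) (by omega), ih j (by omega) (by omega)]

theorem dvd_weightDefect_of_coeff_eq {N r : ℕ} (hr : 1 ≤ r) {c : ℂ} {g : ℂ⟦X⟧}
    (hg : ∀ k < N, coeff k g = coeff k (fussCatalanSeries r c)) :
    X ^ N ∣ weightDefect 1 r g := by
  rw [X_pow_dvd_iff]
  intro k hk
  rw [← map_zero (coeff k), ← weightDefect_fussCatalanSeries hr c, coeff_weightDefect,
    coeff_weightDefect, hg k hk]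
  congr 2
  refine Finset.sum_congr rfl fun ij hij => ?_
  rw [Finset.HasAntidiagonal.mem_antidiagonal] at hij
  rw [hg ij.1 (by omega), hg ij.2 (by omega)]
end

/-! ### Triple products through power series -/

section
open PowerSeries

variable {L : Type*} [AddCommGroup L] [Module ℂ L] {n : ℕ}

/-- The linear map `∑ φ_k x ^ k ↦ ∑ φ_k e_{k + 2}` from power series to the span of `e₂, …, eₙ`. -/
noncomputable def toVec (b : Module.Basis (Fin n) ℂ L) : ℂ⟦X⟧ →ₗ[ℂ] L :=
  ∑ t ∈ Finset.Icc 2 n, (coeff (R := ℂ) (t - 2)).smulRight (basisVec b t)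

/-- The linear map with `e₁ ↦ 1` and `e_{k + 2} ↦ x ^ k`. It kills `e₁ - e₂`, for which all the
products `[[e₁ - e₂, y], z]` vanish. -/
noncomputable def toSeries (b : Module.Basis (Fin n) ℂ L) : L →ₗ[ℂ] ℂ⟦X⟧ :=
  b.constr ℂ fun i => X ^ (i.val - 1)

/-- The coefficient of `e₁`. -/
noncomputable def firstCoord (b : Module.Basis (Fin n) ℂ L) : L →ₗ[ℂ] ℂ :=
  b.constr ℂ fun i => if i.val = 0 then 1 else 0

/-- The coefficient of `e₂`. -/
noncomputable def secondCoord (b : Module.Basis (Fin n) ℂ L) : L →ₗ[ℂ] ℂ :=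
  coeff 0 ∘ₗ toSeries b - firstCoord b

/-- The series `∑_{k ≥ 1} α_{k + 3} x ^ k`. -/
noncomputable def paramSeries (α : ℕ → ℂ) : ℂ⟦X⟧ := mk fun k => if 1 ≤ k then α (k + 3) else 0

/-- The series by which right multiplication by `y` acts on the span of `e₂, …, eₙ`. -/
noncomputable def rightFactor (b : Module.Basis (Fin n) ℂ L) (α : ℕ → ℂ) : L →ₗ[ℂ] ℂ⟦X⟧ :=
  (firstCoord b).smulRight X + (secondCoord b).smulRight (X * paramSeries α)

variable (b : Module.Basis (Fin n) ℂ L)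

theorem toVec_apply (φ : ℂ⟦X⟧) :
    toVec b φ = ∑ t ∈ Finset.Icc 2 n, coeff (t - 2) φ • basisVec b t := by
  simp [toVec]

theorem basisVec_of_lt {t : ℕ} (h : n < t) : basisVec b t = 0 := by
  unfold basisVec; rw [dif_neg]; omega

theorem basisVec_succ {i : ℕ} (h : i < n) : basisVec b (i + 1) = b ⟨i, h⟩ := by
  unfold basisVec; rw [dif_pos (by omega)]; rfl

theorem ext_basisVec {N : Type*} [AddCommGroup N] [Module ℂ N] {f g : L →ₗ[ℂ] N}
    (h1 : f (basisVec b 1) = g (basisVec b 1))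
    (h2 : ∀ k, k + 2 ≤ n → f (basisVec b (k + 2)) = g (basisVec b (k + 2))) : f = g := by
  refine b.ext fun i => ?_
  obtain ⟨i, hi⟩ := i
  rw [← basisVec_succ b hi]
  cases i with
  | zero => exact h1
  | succ k => exact h2 k hi

theorem toVec_X_pow (k : ℕ) : toVec b (X ^ k) = basisVec b (k + 2) := by
  rw [toVec_apply]
  by_cases hk : k + 2 ≤ n
  · rw [Finset.sum_eq_single (k + 2)]
    · simp [coeff_X_pow]
    · intro t ht hne
      rw [Finset.mem_Icc] at ht
      rw [coeff_X_pow, if_neg (by omega), zero_smul]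
    · intro h; simp at h; omega
  · rw [basisVec_of_lt b (by omega)]
    refine Finset.sum_eq_zero fun t ht => ?_
    rw [Finset.mem_Icc] at ht
    rw [coeff_X_pow, if_neg (by omega), zero_smul]

theorem toSeries_one (hn : 3 ≤ n) : toSeries b (basisVec b 1) = 1 := by
  rw [basisVec_succ b (i := 0) (by omega), toSeries, Module.Basis.constr_basis]
  simp

theorem toSeries_basisVec {k : ℕ} (hk : k + 2 ≤ n) : toSeries b (basisVec b (k + 2)) = X ^ k := by
  rw [basisVec_succ b (i := k + 1) (by omega), toSeries, Module.Basis.constr_basis]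
  simp

theorem firstCoord_one (hn : 3 ≤ n) : firstCoord b (basisVec b 1) = 1 := by
  rw [basisVec_succ b (i := 0) (by omega), firstCoord, Module.Basis.constr_basis]
  simp

theorem firstCoord_basisVec (k : ℕ) : firstCoord b (basisVec b (k + 2)) = 0 := by
  by_cases hk : k + 2 ≤ n
  · rw [basisVec_succ b (i := k + 1) (by omega), firstCoord, Module.Basis.constr_basis]
    simp
  · rw [basisVec_of_lt b (by omega), map_zero]

theorem firstCoord_toVec (φ : ℂ⟦X⟧) : firstCoord b (toVec b φ) = 0 := by
  rw [toVec_apply, map_sum]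
  refine Finset.sum_eq_zero fun t ht => ?_
  rw [Finset.mem_Icc] at ht
  obtain ⟨k, rfl⟩ := Nat.exists_eq_add_of_le' ht.1
  rw [map_smul, firstCoord_basisVec, smul_zero]

theorem X_pow_dvd_toSeries_toVec_sub (φ : ℂ⟦X⟧) :
    X ^ (n - 1) ∣ toSeries b (toVec b φ) - φ := by
  rw [X_pow_dvd_iff]
  intro k hk
  rw [toVec_apply, map_sum, map_sub, map_sum, sub_eq_zero, Finset.sum_eq_single (k + 2)]
  · rw [map_smul, toSeries_basisVec b (by omega)]
    simp
  · intro t ht hne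
    rw [Finset.mem_Icc] at ht
    obtain ⟨j, rfl⟩ := Nat.exists_eq_add_of_le' ht.1
    rw [map_smul, toSeries_basisVec b (by omega), map_smul, coeff_X_pow, if_neg (by omega),
      smul_zero]
  · intro h; simp at h; omega

theorem toVec_eq_zero_iff (φ : ℂ⟦X⟧) : toVec b φ = 0 ↔ X ^ (n - 1) ∣ φ := by
  constructor
  · intro h
    have := X_pow_dvd_toSeries_toVec_sub b φ
    rwa [h, map_zero, zero_sub, dvd_neg] at this
  · intro h
    rw [X_pow_dvd_iff] at h
    rw [toVec_apply]
    refine Finset.sum_eq_zero fun t ht => ?_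
    rw [Finset.mem_Icc] at ht
    rw [h _ (by omega), zero_smul]

theorem toVec_eq_iff (φ ψ : ℂ⟦X⟧) : toVec b φ = toVec b ψ ↔ X ^ (n - 1) ∣ φ - ψ := by
  rw [← sub_eq_zero, ← map_sub, toVec_eq_zero_iff]

theorem eq_smul_add_toVec (hn : 3 ≤ n) (v : L) :
    v = firstCoord b v • (basisVec b 1 - basisVec b 2) + toVec b (toSeries b v) := by
  have : LinearMap.id = (firstCoord b).smulRight (basisVec b 1 - basisVec b 2) +
      toVec b ∘ₗ toSeries b := by
    refine ext_basisVec b ?_ fun k hk => ?_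
    · simp [firstCoord_one b hn, toSeries_one b hn, ← toVec_X_pow b 0]
    · simp [firstCoord_basisVec, toSeries_basisVec b hk, toVec_X_pow]
  simpa using LinearMap.congr_fun this v

theorem secondCoord_apply (v : L) : secondCoord b v = coeff 0 (toSeries b v) - firstCoord b v := rfl

theorem rightFactor_apply (α : ℕ → ℂ) (v : L) : rightFactor b α v =
    X * (C (firstCoord b v) + C (secondCoord b v) * paramSeries α) := by
  simp only [rightFactor, LinearMap.add_apply, LinearMap.smulRight_apply, smul_eq_C_mul]
  ring

theorem coeff_zero_paramSeries (α : ℕ → ℂ) : coeff 0 (paramSeries α) = 0 := by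
  simp [paramSeries]

theorem coeff_paramSeries (α : ℕ → ℂ) {k : ℕ} (hk : 1 ≤ k) :
    coeff k (paramSeries α) = α (k + 3) := by
  rw [paramSeries, coeff_mk, if_pos hk]

theorem X_dvd_paramSeries (α : ℕ → ℂ) : X ∣ paramSeries α := by
  rw [X_dvd_iff, ← coeff_zero_eq_constantCoeff_apply, coeff_zero_paramSeries]

variable {b} {br : L →ₗ[ℂ] L →ₗ[ℂ] L} {α : ℕ → ℂ} {θ : ℂ}

theorem bracket_one (hn : 3 ≤ n) (hF : IsFirstFamily br b α θ) (x : L) :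
    br x (basisVec b 1) = toVec b (toSeries b x * X) := by
  have : br.flip (basisVec b 1) = toVec b ∘ₗ LinearMap.mulRight ℂ X ∘ₗ toSeries b := by
    refine ext_basisVec b ?_ fun k hk => ?_
    · simp only [LinearMap.flip_apply, hF.one_one, LinearMap.comp_apply, toSeries_one b hn,
        LinearMap.mulRight_apply, one_mul]
      simpa using (toVec_X_pow b 1).symm
    · simp only [LinearMap.flip_apply, LinearMap.comp_apply, toSeries_basisVec b hk,
        LinearMap.mulRight_apply, ← pow_succ, toVec_X_pow]
      by_cases h : k + 2 = n
      · rw [h, hF.last_one, basisVec_of_lt b (by omega)]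
      · rw [hF.right_one _ (by omega) (by omega)]
  exact LinearMap.congr_fun this x

theorem exists_bracket_two (hn : 3 ≤ n) (hF : IsFirstFamily br b α θ) :
    ∃ κ : ℂ, ∀ x, br x (basisVec b 2) =
      toVec b (toSeries b x * (X * paramSeries α)) + (firstCoord b x * κ) • basisVec b n := by
  -- `[e₁, e₂]` and `[e₂, e₂]` differ only in the coefficient of `eₙ`
  refine ⟨θ - coeff (n - 2) (X * paramSeries α), fun x => ?_⟩
  have : br.flip (basisVec b 2) =
      toVec b ∘ₗ LinearMap.mulRight ℂ (X * paramSeries α) ∘ₗ toSeries b +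
      (firstCoord b).smulRight ((θ - coeff (n - 2) (X * paramSeries α)) • basisVec b n) := by
    refine ext_basisVec b ?_ fun k hk => ?_
    · simp only [LinearMap.flip_apply, hF.one_two, LinearMap.add_apply, LinearMap.comp_apply,
        toSeries_one b hn, LinearMap.mulRight_apply, one_mul, LinearMap.smulRight_apply,
        firstCoord_one b hn, one_smul]
      have hsplit : ∀ F : ℕ → L, ∑ t ∈ Finset.Icc 2 n, F t =
          ∑ t ∈ Finset.Icc 2 (n - 1), F t + F n := by
        intro F
        obtain ⟨m, hm⟩ := Nat.exists_eq_add_of_le' hn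
        rw [hm, show m + 3 - 1 = m + 2 by omega, Finset.sum_Icc_succ_top (by omega)]
      rw [toVec_apply, hsplit, sub_smul, add_add_sub_cancel]
      congr 1
      refine Finset.sum_subset_zero_on_sdiff (Finset.Icc_subset_Icc (by omega) le_rfl) ?_ ?_
      · intro t ht
        rw [Finset.mem_sdiff, Finset.mem_Icc, Finset.mem_Icc] at ht
        obtain ⟨j, rfl⟩ := Nat.exists_eq_add_of_le' ht.1.1
        cases j with
        | zero => simp
        | succ j =>
          obtain rfl : j = 0 := by omega
          rw [show 0 + 1 + 2 - 2 = 0 + 1 by rfl, coeff_succ_X_mul, coeff_zero_paramSeries,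
            zero_smul]
      · intro t ht
        rw [Finset.mem_Icc] at ht
        obtain ⟨j, rfl⟩ := Nat.exists_eq_add_of_le' ht.1
        rw [show j + 4 - 2 = j + 1 + 1 by omega, coeff_succ_X_mul, coeff_paramSeries α (by omega)]
    · simp only [LinearMap.flip_apply, LinearMap.add_apply, LinearMap.comp_apply,
        toSeries_basisVec b hk, LinearMap.mulRight_apply, LinearMap.smulRight_apply,
        firstCoord_basisVec, zero_smul, add_zero, ← mul_assoc, ← pow_succ]
      by_cases h : k + 4 ≤ n
      · rw [hF.right_two _ (by omega) (by omega), toVec_apply]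
        refine Finset.sum_subset_zero_on_sdiff (Finset.Icc_subset_Icc (by omega) le_rfl) ?_ ?_
        · intro t ht
          rw [Finset.mem_sdiff, Finset.mem_Icc, Finset.mem_Icc] at ht
          rw [coeff_X_pow_mul']
          split_ifs with h'
          · rw [show t - 2 - (k + 1) = 0 by omega, coeff_zero_paramSeries, zero_smul]
          · rw [zero_smul]
        · intro t ht
          rw [Finset.mem_Icc] at ht
          rw [coeff_X_pow_mul', if_pos (by omega), coeff_paramSeries α (by omega)]
          congr 2
          omega
      · rw [hF.last_two _ (by omega) (by omega) (by omega), eq_comm, toVec_eq_zero_iff]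
        obtain ⟨g', hg'⟩ := X_dvd_paramSeries α
        rw [hg', ← mul_assoc, ← pow_succ]
        exact Dvd.dvd.mul_right (pow_dvd_pow _ (by omega)) _
  have h := LinearMap.congr_fun this x
  simpa only [LinearMap.flip_apply, LinearMap.add_apply, LinearMap.comp_apply, mul_smul,
    LinearMap.mulRight_apply, LinearMap.smulRight_apply] using h

theorem exists_bracket_eq (hn : 3 ≤ n) (hF : IsFirstFamily br b α θ) :
    ∃ κ : ℂ, ∀ x y, br x y = toVec b (toSeries b x * rightFactor b α y) +
      (secondCoord b y * (firstCoord b x * κ)) • basisVec b n := by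
  obtain ⟨κ, hκ⟩ := exists_bracket_two hn hF
  refine ⟨κ, fun x y => ?_⟩
  have : br x = toVec b ∘ₗ LinearMap.mulLeft ℂ (toSeries b x) ∘ₗ rightFactor b α +
      (secondCoord b).smulRight ((firstCoord b x * κ) • basisVec b n) := by
    refine ext_basisVec b ?_ fun k hk => ?_
    · simp [bracket_one hn hF, rightFactor_apply, firstCoord_one b hn, secondCoord_apply,
        toSeries_one b hn]
    · cases k with
      | zero =>
        simp [hκ, rightFactor_apply, firstCoord_basisVec b 0, secondCoord_apply,
          toSeries_basisVec b hk]
      | succ k =>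
        have hz : br.flip (basisVec b (k + 1 + 2)) = 0 := by
          refine ext_basisVec b ?_ fun j hj => ?_
          · simp [hF.right_ge_three 1 (k + 1 + 2) (by omega) (by omega) (by omega) hk]
          · simp [hF.right_ge_three (j + 2) (k + 1 + 2) (by omega) hj (by omega) hk]
        have hz' : br x (basisVec b (k + 1 + 2)) = 0 := LinearMap.congr_fun hz x
        simp [hz', rightFactor_apply, firstCoord_basisVec b (k + 1), secondCoord_apply,
          toSeries_basisVec b hk]
  rw [this]
  simp [mul_smul]

/-- Triple products only involve the power series model: neither `θ` nor the component along
`e₁ - e₂` of the leftmost factor matters. -/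
theorem triple_bracket (hn : 3 ≤ n) (hF : IsFirstFamily br b α θ) (x y z : L) :
    br (br x y) z = toVec b (toSeries b x * rightFactor b α y * rightFactor b α z) := by
  obtain ⟨κ, hκ⟩ := exists_bracket_eq hn hF
  have hn2 : basisVec b n = toVec b (X ^ (n - 2)) := by
    rw [toVec_X_pow, Nat.sub_add_cancel (by omega)]
  have h1 : firstCoord b (br x y) = 0 := by
    rw [hκ, hn2, map_add, firstCoord_toVec, map_smul, firstCoord_toVec, smul_zero, add_zero]
  rw [hκ (br x y), h1, zero_mul, mul_zero, zero_smul, add_zero, toVec_eq_iff, hκ x y, hn2,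
    ← map_smul, ← map_add]
  obtain ⟨ψ, hψ⟩ := X_pow_dvd_toSeries_toVec_sub b (toSeries b x * rightFactor b α y +
    (secondCoord b y * (firstCoord b x * κ)) • X ^ (n - 2))
  rw [sub_eq_iff_eq_add] at hψ
  rw [hψ, rightFactor_apply b α z, smul_eq_C_mul, show n - 1 = n - 2 + 1 by omega]
  refine ⟨X * ψ * (C (firstCoord b z) + C (secondCoord b z) * paramSeries α) +
    C (secondCoord b y * (firstCoord b x * κ)) *
      (C (firstCoord b z) + C (secondCoord b z) * paramSeries α), ?_⟩
  ring
end

/-! ### Pre-derivations with a nonzero eigenvalue -/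

section
open PowerSeries

theorem rescale_neg_one_C (c : ℂ) : rescale (-1) (C c) = C c := by
  ext k
  rw [coeff_rescale, coeff_C]
  split_ifs with h <;> simp [h]

/-- The part of odd degree of a power series. -/
noncomputable def oddPart : ℂ⟦X⟧ →ₗ[ℂ] ℂ⟦X⟧ where
  toFun φ := C (1 / 2) * (φ - rescale (-1) φ)
  map_add' φ ψ := by rw [map_add]; ring
  map_smul' c φ := by
    rw [smul_eq_C_mul, map_mul, rescale_neg_one_C, RingHom.id_apply, smul_eq_C_mul]; ring

theorem oddPart_apply (φ : ℂ⟦X⟧) : oddPart φ = C (1 / 2) * (φ - rescale (-1) φ) := rfl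

theorem coeff_oddPart (φ : ℂ⟦X⟧) (k : ℕ) :
    coeff k (oddPart φ) = if Odd k then coeff k φ else 0 := by
  rw [oddPart_apply, coeff_C_mul, map_sub, coeff_rescale]
  split_ifs with h
  · rw [h.neg_one_pow]; ring
  · rw [(Nat.not_odd_iff_even.1 h).neg_one_pow]; ring

theorem oddPart_X_sq_mul (φ : ℂ⟦X⟧) : oddPart (X ^ 2 * φ) = X ^ 2 * oddPart φ := by
  simp only [oddPart_apply, map_mul, map_pow, rescale_neg_one_X]; ring

theorem oddPart_X : oddPart X = X := by
  ext k
  rw [coeff_oddPart, coeff_X]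
  split_ifs with h1 h2 h2 <;> first | rfl | (subst h2; simp at h1)

theorem oddPart_one : oddPart 1 = 0 := by
  ext k
  rw [coeff_oddPart, coeff_one]
  split_ifs with h1 h2 <;> first | rfl | (subst h2; simp at h1)

theorem oddPart_X_mul (φ : ℂ⟦X⟧) : oddPart (X * φ) = X * (φ - oddPart φ) := by
  have h : C (1 / 2 : ℂ) + C (1 / 2) = 1 := by rw [← map_add]; norm_num
  simp only [oddPart_apply, map_mul, rescale_neg_one_X]
  linear_combination (X * φ) * h

theorem X_pow_dvd_oddPart {N : ℕ} {φ : ℂ⟦X⟧} (h : X ^ N ∣ φ) : X ^ N ∣ oddPart φ := by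
  rw [X_pow_dvd_iff] at h ⊢
  intro k hk
  rw [coeff_oddPart, h k hk, ite_self]

theorem X_pow_dvd_X_mul_derivative {N : ℕ} {φ : ℂ⟦X⟧} (h : X ^ N ∣ φ) :
    X ^ N ∣ X * d⁄dX ℂ φ := by
  rw [X_pow_dvd_iff] at h ⊢
  intro k hk
  rw [coeff_X_mul_derivative, h k hk, mul_zero]

theorem exists_eq_X_pow_mul_unit {G : ℂ⟦X⟧} (hG : G ≠ 0) :
    ∃ (v : ℕ) (u : ℂ⟦X⟧ˣ), G = (X : ℂ⟦X⟧) ^ v * (u : ℂ⟦X⟧) := by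
  obtain ⟨u, hu⟩ := isUnit_divided_by_X_pow_order hG
  exact ⟨G.order.toNat, u, by rw [hu, X_pow_order_mul_divXPowOrder]⟩

/-- The operator `a + b + (a + b g) x d/dx + h π`, with `π` the projection to the part of odd
degree. -/
noncomputable def weightOperator (a b : ℂ) (g h : ℂ⟦X⟧) : ℂ⟦X⟧ →ₗ[ℂ] ℂ⟦X⟧ :=
  (a + b) • LinearMap.id +
    LinearMap.mulLeft ℂ (C a + C b * g) ∘ₗ LinearMap.mulLeft ℂ X ∘ₗ (d⁄dX ℂ : ℂ⟦X⟧ →ₗ[ℂ] ℂ⟦X⟧) +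
    LinearMap.mulLeft ℂ h ∘ₗ oddPart

theorem weightOperator_apply (a b : ℂ) (g h φ : ℂ⟦X⟧) : weightOperator a b g h φ =
    C (a + b) * φ + (C a + C b * g) * (X * d⁄dX ℂ φ) + h * oddPart φ := by
  simp [weightOperator, smul_eq_C_mul]

theorem X_pow_dvd_weightOperator (a b : ℂ) (g h : ℂ⟦X⟧) {N : ℕ} {φ : ℂ⟦X⟧} (hφ : X ^ N ∣ φ) :
    X ^ N ∣ weightOperator a b g h φ := by
  rw [weightOperator_apply]
  exact dvd_add (dvd_add (hφ.mul_left _) ((X_pow_dvd_X_mul_derivative hφ).mul_left _))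
    ((X_pow_dvd_oddPart hφ).mul_left _)

theorem coeff_zero_weightOperator (a b : ℂ) (g h φ : ℂ⟦X⟧) :
    coeff 0 (weightOperator a b g h φ) = (a + b) * coeff 0 φ := by
  have h1 : coeff 0 (oddPart φ) = 0 := by rw [coeff_oddPart]; simp
  rw [coeff_zero_eq_constantCoeff_apply] at h1 ⊢
  rw [weightOperator_apply]
  simp [h1]

/-- The failure of the weight operator to act as a derivation on products with `x ^ 2 * Y * Z`,
where `Y = y₁ + y₂ g` and `Z = z₁ + z₂ g`. -/
theorem weightOperator_mul_sub (a b y₁ y₂ z₁ z₂ : ℂ) (g h m : ℂ⟦X⟧) :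
    weightOperator a b g h (m * (X * (C y₁ + C y₂ * g)) * (X * (C z₁ + C z₂ * g))) -
      (weightOperator a b g h m * (X * (C y₁ + C y₂ * g)) * (X * (C z₁ + C z₂ * g)) +
        m * (X * (C (a * y₁) + C ((a + b) * y₂ + b * y₁) * g)) * (X * (C z₁ + C z₂ * g)) +
        m * (X * (C y₁ + C y₂ * g)) * (X * (C (a * z₁) + C ((a + b) * z₂ + b * z₁) * g))) =
    X ^ 2 * (m * weightDefect a b g * (C (y₁ * z₂ + y₂ * z₁) + 2 * C (y₂ * z₂) * g) +
      h * oddPart g * (C (y₁ * z₂ + y₂ * z₁) + C (y₂ * z₂) * (g + rescale (-1) g)) *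
        rescale (-1) m) := by
  simp only [weightOperator_apply, weightDefect, oddPart_apply, Derivation.leibniz, map_add,
    map_mul, derivative_C, derivative_X, rescale_neg_one_X, rescale_neg_one_C, smul_eq_mul]
  ring

theorem X_dvd_sub_rescale (φ : ℂ⟦X⟧) : X ∣ φ - rescale (-1) φ := by
  rw [X_dvd_iff, ← coeff_zero_eq_constantCoeff_apply, map_sub, coeff_rescale]
  simp

theorem X_pow_dvd_weightOperator_mul_sub {n : ℕ} (a b y₁ y₂ z₁ z₂ : ℂ) {g h : ℂ⟦X⟧} (m : ℂ⟦X⟧)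
    (hg : X ∣ g) (hE : X ^ (n - 4) ∣ weightDefect a b g)
    (hh : X ^ (n - 3) ∣ weightDefect a b g + h * oddPart g) :
    X ^ (n - 1) ∣ weightOperator a b g h (m * (X * (C y₁ + C y₂ * g)) * (X * (C z₁ + C z₂ * g))) -
      (weightOperator a b g h m * (X * (C y₁ + C y₂ * g)) * (X * (C z₁ + C z₂ * g)) +
        m * (X * (C (a * y₁) + C ((a + b) * y₂ + b * y₁) * g)) * (X * (C z₁ + C z₂ * g)) +
        m * (X * (C y₁ + C y₂ * g)) *
          (X * (C (a * z₁) + C ((a + b) * z₂ + b * z₁) * g))) := by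
  rw [weightOperator_mul_sub]
  obtain ⟨E, hE⟩ := hE
  obtain ⟨W, hW⟩ := hh
  obtain ⟨m', hm'⟩ := X_dvd_sub_rescale m
  obtain ⟨g', rfl⟩ := hg
  set B := C (y₁ * z₂ + y₂ * z₁)
  set D := C (y₂ * z₂)
  set F := weightDefect a b (X * g')
  have hrg : rescale (-1) (X * g') = -(X * rescale (-1) g') := by
    rw [map_mul, rescale_neg_one_X]; ring
  have key : X ^ 2 * (m * F * (B + 2 * D * (X * g')) + h * oddPart (X * g') *
      (B + D * (X * g' + rescale (-1) (X * g'))) * rescale (-1) m) =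
      (X ^ 2 * X ^ (n - 3)) * (W * (B + D * (X * g' + rescale (-1) (X * g'))) * rescale (-1) m) +
      (X ^ 2 * X ^ (n - 4) * X) * (E * (B * m' + D * (2 * g' * m -
        (g' - rescale (-1) g') * rescale (-1) m))) := by
    rw [hrg]
    linear_combination (X ^ 2 * (B + D * (X * g' - X * rescale (-1) g')) * rescale (-1) m) * hW +
      X ^ 2 * (B * X * m' + D * (2 * X * g' * m -
        (X * g' - X * rescale (-1) g') * rescale (-1) m)) * hE + X ^ 2 * B * F * hm'
  rw [key]
  refine dvd_add (Dvd.dvd.mul_right ?_ _) (Dvd.dvd.mul_right ?_ _)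
  · rw [← pow_add]; exact pow_dvd_pow _ (by omega)
  · rw [← pow_add, ← pow_succ]; exact pow_dvd_pow _ (by omega)

variable {L : Type*} [AddCommGroup L] [Module ℂ L] {n : ℕ}

/-- The endomorphism of `L` that scales `e₁ - e₂` by `a` and acts on the span of `e₂, …, eₙ` by
the weight operator. -/
noncomputable def weightMap (b : Module.Basis (Fin n) ℂ L) (a c : ℂ) (g h : ℂ⟦X⟧) :
    Module.End ℂ L :=
  (firstCoord b).smulRight (a • (basisVec b 1 - basisVec b 2)) +
    toVec b ∘ₗ weightOperator a c g h ∘ₗ toSeries b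

variable (b : Module.Basis (Fin n) ℂ L)

theorem weightMap_apply (a c : ℂ) (g h : ℂ⟦X⟧) (v : L) :
    weightMap b a c g h v = firstCoord b v • a • (basisVec b 1 - basisVec b 2) +
      toVec b (weightOperator a c g h (toSeries b v)) := rfl

theorem toSeries_one_sub_two (hn : 3 ≤ n) : toSeries b (basisVec b 1 - basisVec b 2) = 0 := by
  rw [map_sub, toSeries_one b hn, toSeries_basisVec b (k := 0) (by omega), pow_zero, sub_self]

theorem firstCoord_one_sub_two (hn : 3 ≤ n) : firstCoord b (basisVec b 1 - basisVec b 2) = 1 := by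
  rw [map_sub, firstCoord_one b hn, firstCoord_basisVec b 0, sub_zero]

theorem rightFactor_weightMap (hn : 3 ≤ n) (α : ℕ → ℂ) (a c : ℂ) (g h : ℂ⟦X⟧) (v : L) :
    rightFactor b α (weightMap b a c g h v) = X * (C (a * firstCoord b v) +
      C ((a + c) * secondCoord b v + c * firstCoord b v) * paramSeries α) := by
  have h1 : firstCoord b (weightMap b a c g h v) = a * firstCoord b v := by
    rw [weightMap_apply, map_add, firstCoord_toVec, map_smul, map_smul,
      firstCoord_one_sub_two b hn]
    simp [mul_comm]
  have h2 := X_pow_dvd_toSeries_toVec_sub b (weightOperator a c g h (toSeries b v))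
  rw [X_pow_dvd_iff] at h2
  have h3 := h2 0 (by omega)
  rw [map_sub, sub_eq_zero, coeff_zero_weightOperator] at h3
  have h4 : secondCoord b (weightMap b a c g h v) =
      (a + c) * secondCoord b v + c * firstCoord b v := by
    rw [secondCoord_apply, h1, weightMap_apply, map_add, map_smul, map_smul,
      toSeries_one_sub_two b hn, smul_zero, smul_zero, zero_add, h3, secondCoord_apply]
    ring
  rw [rightFactor_apply, h1, h4]

variable {b} {br : L →ₗ[ℂ] L →ₗ[ℂ] L} {α : ℕ → ℂ} {θ : ℂ}

/-- The weight equation may fail in degree `n - 4`, provided that `h` compensates for the failure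
there. -/
theorem isPreDerivation_weightMap (hn : 3 ≤ n) (hF : IsFirstFamily br b α θ) {a c : ℂ} {h : ℂ⟦X⟧}
    (hE : X ^ (n - 4) ∣ weightDefect a c (paramSeries α))
    (hh : X ^ (n - 3) ∣ weightDefect a c (paramSeries α) + h * oddPart (paramSeries α)) :
    IsPreDerivation br (weightMap b a c (paramSeries α) h) := by
  intro x y z
  set g := paramSeries α
  simp only [triple_bracket hn hF, ← map_add, rightFactor_weightMap b hn]
  rw [weightMap_apply, firstCoord_toVec, zero_smul, zero_add, toVec_eq_iff]
  have h1 := X_pow_dvd_weightOperator a c g h (X_pow_dvd_toSeries_toVec_sub b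
    (toSeries b x * rightFactor b α y * rightFactor b α z))
  have h2 : X ^ (n - 1) ∣ toSeries b (weightMap b a c g h x) -
      weightOperator a c g h (toSeries b x) := by
    rw [weightMap_apply, map_add, map_smul, map_smul, toSeries_one_sub_two b hn, smul_zero,
      smul_zero, zero_add]
    exact X_pow_dvd_toSeries_toVec_sub b _
  have h3 := X_pow_dvd_weightOperator_mul_sub (n := n) a c (firstCoord b y) (secondCoord b y)
    (firstCoord b z) (secondCoord b z) (toSeries b x) (X_dvd_paramSeries α) hE hh
  simp only [rightFactor_apply b α] at h1 ⊢
  rw [map_sub] at h1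
  have h4 := (h2.mul_right (X * (C (firstCoord b y) + C (secondCoord b y) * g) *
    (X * (C (firstCoord b z) + C (secondCoord b z) * g))))
  have h5 := dvd_sub (dvd_add h1 h3) h4
  convert h5 using 1
  ring

theorem not_isNilpotent_of_apply_eq_smul {P : Module.End ℂ L} {μ : ℂ} (hμ : μ ≠ 0) {v : L}
    (hv : v ≠ 0) (h : P v = μ • v) : ¬ IsNilpotent P := by
  rintro ⟨k, hk⟩
  have h1 : ∀ k : ℕ, (P ^ k) v = μ ^ k • v := by
    intro k
    induction k with
    | zero => simp
    | succ k ih => rw [pow_succ', Module.End.mul_apply, ih, map_smul, h, smul_smul, pow_succ]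
  have h2 := h1 k
  rw [hk, LinearMap.zero_apply, eq_comm, smul_eq_zero] at h2
  exact h2.elim (pow_ne_zero k hμ) hv

theorem not_isStronglyNilpotent_of_oddPart (hn : 3 ≤ n) (hF : IsFirstFamily br b α θ)
    (h : X ^ (n - 3) ∣ oddPart (paramSeries α)) : ¬ IsStronglyNilpotent br := by
  intro hS
  have hE : weightDefect 0 0 (paramSeries α) = 0 := by simp [weightDefect]
  have hP := isPreDerivation_weightMap (a := 0) (c := 0) (h := 1) hn hF
    (by rw [hE]; exact dvd_zero _) (by rw [hE, zero_add, one_mul]; exact h)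
  have h3 : basisVec b 3 ≠ 0 := by
    rw [basisVec_succ b (i := 2) (by omega)]; exact b.ne_zero _
  refine not_isNilpotent_of_apply_eq_smul one_ne_zero h3 ?_ (hS _ hP)
  have hX := toSeries_basisVec b (k := 1) (by omega)
  have hc := firstCoord_basisVec b 1
  have hV := toVec_X_pow b 1
  simp only [pow_one, Nat.reduceAdd] at hX hc hV
  rw [weightMap_apply, hX, hc, zero_smul, zero_add, weightOperator_apply, oddPart_X]
  simp [hV]

/-- It is enough to solve the weight equation modulo `x ^ (n - 4)`: if the odd part of `g` is
nonzero modulo `x ^ (n - 3)`, a multiple of it cancels the error in degree `n - 4`. -/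
theorem not_isStronglyNilpotent_of_weightDefect (hn : 5 ≤ n) (hF : IsFirstFamily br b α θ)
    {a c : ℂ} (ha : a ≠ 0) (hE : X ^ (n - 4) ∣ weightDefect a c (paramSeries α)) :
    ¬ IsStronglyNilpotent br := by
  by_cases hodd : X ^ (n - 3) ∣ oddPart (paramSeries α)
  · exact not_isStronglyNilpotent_of_oddPart (by omega) hF hodd
  have hG0 : oddPart (paramSeries α) ≠ 0 := fun h => hodd (h ▸ dvd_zero _)
  obtain ⟨v, u, hGu⟩ := exists_eq_X_pow_mul_unit hG0
  have hv : v < n - 3 := by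
    by_contra! hle
    apply hodd
    rw [hGu]
    exact (pow_dvd_pow _ hle).mul_right _
  obtain ⟨E, hE'⟩ := hE
  intro hS
  -- the odd part of `g` is `x ^ v * u`, and this `h` makes `weightDefect + h * oddPart g` zero
  have hP := isPreDerivation_weightMap (a := a) (c := c)
    (h := -(X ^ (n - 4 - v) * E * ((u⁻¹ : ℂ⟦X⟧ˣ) : ℂ⟦X⟧))) (by omega) hF ⟨E, hE'⟩ (by
      suffices h : weightDefect a c (paramSeries α) +
          -(X ^ (n - 4 - v) * E * ((u⁻¹ : ℂ⟦X⟧ˣ) : ℂ⟦X⟧)) * oddPart (paramSeries α) = 0 by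
        rw [h]; exact dvd_zero _
      have h1 : (X : ℂ⟦X⟧) ^ (n - 4) = X ^ (n - 4 - v) * X ^ v := by
        rw [← pow_add]; congr 1; omega
      rw [hE', h1, hGu]
      linear_combination
        (-(X ^ (n - 4 - v) * E * X ^ v)) * u.inv_mul)
  have hu0 : basisVec b 1 - basisVec b 2 ≠ 0 := by
    intro h0
    have := firstCoord_one_sub_two b (by omega)
    rw [h0, map_zero] at this
    exact zero_ne_one this
  refine not_isNilpotent_of_apply_eq_smul ha hu0 ?_ (hS _ hP)
  rw [weightMap_apply, firstCoord_one_sub_two b (by omega), toSeries_one_sub_two b (by omega),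
    map_zero, map_zero, add_zero, one_smul]
end

/-! ### The constraints on a pre-derivation that is not nilpotent -/

section
open PowerSeries

theorem X_pow_dvd_of_mul {N k : ℕ} {φ : ℂ⟦X⟧} (h : X ^ (N + k) ∣ X ^ k * φ) : X ^ N ∣ φ := by
  rw [add_comm, pow_add] at h
  exact (mul_dvd_mul_iff_left (pow_ne_zero k X_ne_zero)).1 h

theorem eq_C_add_X_mul (φ : ℂ⟦X⟧) : ∃ ψ : ℂ⟦X⟧, φ = C (coeff 0 φ) + X * ψ := by
  have h : X ∣ φ - C (coeff 0 φ) := by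
    rw [X_dvd_iff, ← coeff_zero_eq_constantCoeff_apply, map_sub, coeff_zero_C, sub_self]
  obtain ⟨ψ, hψ⟩ := h
  exact ⟨ψ, by rw [← hψ]; ring⟩

/-- An operator that is linear over the even powers of `x` modulo `x ^ N` and vanishes on `1` and
`x` vanishes modulo `x ^ N`. -/
theorem X_pow_dvd_of_X_sq_linear {N : ℕ} (F : ℂ⟦X⟧ →ₗ[ℂ] ℂ⟦X⟧)
    (h2 : ∀ φ, X ^ N ∣ F (X ^ 2 * φ) - X ^ 2 * F φ) (h0 : X ^ N ∣ F 1) (h1 : X ^ N ∣ F X)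
    (φ : ℂ⟦X⟧) : X ^ N ∣ F φ := by
  suffices h : ∀ k ≤ N, ∀ φ, X ^ k ∣ F φ from h N le_rfl φ
  intro k
  induction k with
  | zero => simp
  | succ k ih =>
    intro hk φ
    obtain ⟨φ₁, hφ₁⟩ := eq_C_add_X_mul φ
    obtain ⟨φ₂, hφ₂⟩ := eq_C_add_X_mul φ₁
    have h : φ = coeff 0 φ • 1 + coeff 0 φ₁ • X + X ^ 2 * φ₂ := by
      rw [smul_eq_C_mul, smul_eq_C_mul]
      linear_combination hφ₁ + X * hφ₂
    have hle : (X : ℂ⟦X⟧) ^ (k + 1) ∣ X ^ N := pow_dvd_pow _ hk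
    rw [h, map_add, map_add, map_smul, map_smul, smul_eq_C_mul, smul_eq_C_mul]
    refine dvd_add (dvd_add ((hle.trans h0).mul_left _) ((hle.trans h1).mul_left _)) ?_
    refine (dvd_iff_dvd_of_dvd_sub (hle.trans (h2 φ₂))).2 ?_
    rw [pow_succ', pow_two, mul_assoc]
    exact mul_dvd_mul_left _ ((ih (by omega) φ₂).mul_left _)

/-- The error of an operator `D` against the first-order operator `D 1 + (a + b g) x d/dx`. -/
noncomputable def derivationDefect (D : ℂ⟦X⟧ →ₗ[ℂ] ℂ⟦X⟧) (a b : ℂ) (g : ℂ⟦X⟧) :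
    ℂ⟦X⟧ →ₗ[ℂ] ℂ⟦X⟧ :=
  D - LinearMap.mulLeft ℂ (D 1) -
    LinearMap.mulLeft ℂ (C a + C b * g) ∘ₗ LinearMap.mulLeft ℂ X ∘ₗ (d⁄dX ℂ : ℂ⟦X⟧ →ₗ[ℂ] ℂ⟦X⟧)

variable {D : ℂ⟦X⟧ →ₗ[ℂ] ℂ⟦X⟧} {a b a' b' : ℂ} {g : ℂ⟦X⟧} {N : ℕ}

theorem derivationDefect_apply (φ : ℂ⟦X⟧) : derivationDefect D a b g φ =
    D φ - D 1 * φ - (C a + C b * g) * (X * d⁄dX ℂ φ) := by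
  simp [derivationDefect]

theorem derivationDefect_one : derivationDefect D a b g 1 = 0 := by
  rw [derivationDefect_apply, mul_one, sub_self, zero_sub, neg_eq_zero, derivative_one,
    mul_zero, mul_zero]

/-- The defect only sees the odd part of its argument; the factor `x` avoids a division. -/
theorem X_mul_derivationDefect
    (h1 : ∀ φ, X ^ N ∣ D (X ^ 2 * φ) - (X ^ 2 * D φ + 2 * X ^ 2 * φ * (C a + C b * g)))
    (φ : ℂ⟦X⟧) :
    X ^ N ∣ X * derivationDefect D a b g φ - derivationDefect D a b g X * oddPart φ := by
  let F : ℂ⟦X⟧ →ₗ[ℂ] ℂ⟦X⟧ := LinearMap.mulLeft ℂ X ∘ₗ derivationDefect D a b g -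
    LinearMap.mulLeft ℂ (derivationDefect D a b g X) ∘ₗ oddPart
  have hF : ∀ ψ, F ψ =
    X * derivationDefect D a b g ψ - derivationDefect D a b g X * oddPart ψ := fun ψ => rfl
  rw [← hF]
  refine X_pow_dvd_of_X_sq_linear F (fun ψ => ?_) ?_ ?_ φ
  · rw [hF, hF, oddPart_X_sq_mul, derivationDefect_apply (X ^ 2 * ψ), derivationDefect_apply ψ]
    convert (h1 ψ).mul_left X using 1
    simp only [pow_two, Derivation.leibniz, derivative_X, smul_eq_mul]
    ring
  · rw [hF, derivationDefect_one, oddPart_one, mul_zero, mul_zero, sub_zero]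
    exact dvd_zero _
  · rw [hF, oddPart_X, mul_comm, sub_self]
    exact dvd_zero _

/-- Comparing the two relations for products with `g` on `φ = 1` and on `φ = x` separates the weight
equation from the contribution of the odd part. -/
theorem weight_relations (hN : 3 ≤ N)
    (h1 : ∀ φ, X ^ N ∣ D (X ^ 2 * φ) - (X ^ 2 * D φ + 2 * X ^ 2 * φ * (C a + C b * g)))
    (h2 : ∀ φ, X ^ N ∣ D (X ^ 2 * (g * φ)) - (X ^ 2 * g * D φ +
      X ^ 2 * φ * g * (C a + C b * g) + X ^ 2 * φ * (C a' + C b' * g))) :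
    X ^ (N - 1) ∣ derivationDefect D a b g X * oddPart g +
        X * ((C a + C b * g) * (X * d⁄dX ℂ g) + C (a - b') * g + C b * g ^ 2 - C a') ∧
      X ^ (N - 3) ∣ (C a + C b * g) * (X * d⁄dX ℂ g) + C (a - b') * g + C b * g ^ 2 - C a' := by
  set F := (C a + C b * g) * (X * d⁄dX ℂ g) + C (a - b') * g + C b * g ^ 2 - C a' with hF
  set H := derivationDefect D a b g X
  have key : ∀ φ, X ^ (N - 1) ∣ H * oddPart (g * φ) - g * (H * oddPart φ) + X * φ * F := by
    intro φ
    have h3 : X ^ (N - 1) ∣ X * (derivationDefect D a b g (g * φ) -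
        g * derivationDefect D a b g φ + φ * F) := by
      apply X_pow_dvd_of_mul (k := 1)
      rw [Nat.sub_add_cancel (by omega)]
      convert dvd_sub (h2 φ) (h1 (g * φ)) using 1
      simp only [derivationDefect_apply, Derivation.leibniz, smul_eq_mul, hF, map_sub]
      ring
    have hle : (X : ℂ⟦X⟧) ^ (N - 1) ∣ X ^ N := pow_dvd_pow _ (by omega)
    have h4 := hle.trans (X_mul_derivationDefect h1 (g * φ))
    have h5 := (hle.trans (X_mul_derivationDefect h1 φ)).mul_left g
    convert dvd_add (dvd_sub h3 h4) h5 using 1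
    ring
  have k1 := key 1
  have k2 := key X
  rw [mul_one, oddPart_one, mul_zero, mul_zero, sub_zero, mul_one] at k1
  rw [mul_comm g X, oddPart_X_mul, oddPart_X] at k2
  refine ⟨k1, ?_⟩
  apply X_pow_dvd_of_mul (k := 2)
  rw [show N - 3 + 2 = N - 1 by omega]
  have h6 := (dvd_add (k1.mul_left X) k2).mul_left (C (1 / 2))
  convert h6 using 1
  have h : C (1 / 2 : ℂ) + C (1 / 2) = 1 := by rw [← map_add]; norm_num
  linear_combination (-(X ^ 2 * F)) * h

/-- If the weights vanish and the odd part of `g` does not, then `D` raises the order. -/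
theorem X_pow_succ_dvd_of_zero_weights (hN : 4 ≤ N)
    (h1 : ∀ φ, X ^ N ∣ D (X ^ 2 * φ) - X ^ 2 * D φ) (h2 : X ∣ D 1)
    (h3 : X ^ (N - 1) ∣ derivationDefect D 0 0 g X * oddPart g)
    (hg : ¬ X ^ (N - 2) ∣ oddPart g) {k : ℕ} (hk : k + 1 ≤ N) {φ : ℂ⟦X⟧} (hφ : X ^ k ∣ φ) :
    X ^ (k + 1) ∣ D φ := by
  have hH : X ^ 2 ∣ derivationDefect D 0 0 g X := by
    obtain ⟨v, u, hu⟩ := exists_eq_X_pow_mul_unit (G := oddPart g) (fun h => hg (h ▸ dvd_zero _))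
    have hv : v < N - 2 := by
      by_contra! hle
      apply hg
      rw [hu]
      exact (pow_dvd_pow _ hle).mul_right _
    rw [hu, mul_left_comm] at h3
    have h4 : X ^ (N - 1 - v) ∣ derivationDefect D 0 0 g X * (u : ℂ⟦X⟧) := by
      apply X_pow_dvd_of_mul (k := v)
      rwa [Nat.sub_add_cancel (by omega)]
    exact (pow_dvd_pow _ (by omega)).trans ((Units.dvd_mul_right).1 h4)
  have hle : ∀ {m : ℕ}, m ≤ N → ∀ ψ, X ^ m ∣ X * D ψ -
      (D 1 * (X * ψ) + derivationDefect D 0 0 g X * oddPart ψ) := by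
    intro m hm ψ
    refine (pow_dvd_pow _ hm).trans ?_
    convert X_mul_derivationDefect (D := D) (a := 0) (b := 0) (g := g) (N := N)
      (by simpa using h1) ψ using 1
    rw [derivationDefect_apply ψ, map_zero]
    ring
  induction k using Nat.twoStepInduction generalizing φ with
  | zero =>
    apply X_pow_dvd_of_mul (k := 1)
    have h5 : X ^ (0 + 1 + 1) ∣ D 1 * (X * φ) + derivationDefect D 0 0 g X * oddPart φ :=
      dvd_add (by rw [pow_succ, pow_one]; exact mul_dvd_mul h2 (dvd_mul_right _ _))
        (hH.mul_right _)
    rw [pow_one X]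
    exact (dvd_iff_dvd_of_dvd_sub (hle (by omega) φ)).2 h5
  | one =>
    apply X_pow_dvd_of_mul (k := 1)
    have h5 : X ^ (1 + 1 + 1) ∣ D 1 * (X * φ) + derivationDefect D 0 0 g X * oddPart φ := by
      refine dvd_add ?_ ?_
      · rw [show (X : ℂ⟦X⟧) ^ (1 + 1 + 1) = X * (X * X ^ 1) by ring]
        exact mul_dvd_mul h2 (mul_dvd_mul_left _ hφ)
      · rw [show (X : ℂ⟦X⟧) ^ (1 + 1 + 1) = X ^ 2 * X ^ 1 by ring]
        exact mul_dvd_mul hH (X_pow_dvd_oddPart hφ)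
    rw [pow_one X]
    exact (dvd_iff_dvd_of_dvd_sub (hle (by omega) φ)).2 h5
  | more k ih _ =>
    obtain ⟨ψ, rfl⟩ := hφ
    have h5 := ih (φ := X ^ k * ψ) (by omega) (dvd_mul_right _ _)
    rw [show X ^ (k + 2) * ψ = X ^ 2 * (X ^ k * ψ) by ring]
    refine (dvd_iff_dvd_of_dvd_sub ((pow_dvd_pow _ hk).trans (h1 (X ^ k * ψ)))).2 ?_
    rw [show k + 2 + 1 = 2 + (k + 1) by ring, pow_add]
    exact mul_dvd_mul_left _ h5
end

section
open PowerSeries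

variable {L : Type*} [AddCommGroup L] [Module ℂ L] {n : ℕ} {b : Module.Basis (Fin n) ℂ L}
  {br : L →ₗ[ℂ] L →ₗ[ℂ] L} {α : ℕ → ℂ} {θ : ℂ} {P : Module.End ℂ L}

theorem toVec_mul_congr {φ ψ χ : ℂ⟦X⟧} (h : X ^ (n - 1) ∣ φ - ψ) :
    toVec b (φ * χ) = toVec b (ψ * χ) := by
  rw [toVec_eq_iff, ← sub_mul]
  exact h.mul_right _

/-- A pre-derivation, read on the power series model. -/
theorem IsPreDerivation.series_relation (hn : 3 ≤ n) (hF : IsFirstFamily br b α θ)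
    (hP : IsPreDerivation br P) (φ : ℂ⟦X⟧) (y z : L) :
    X ^ (n - 1) ∣ toSeries b (P (toVec b (φ * rightFactor b α y * rightFactor b α z))) -
      (toSeries b (P (toVec b φ)) * rightFactor b α y * rightFactor b α z +
        φ * rightFactor b α (P y) * rightFactor b α z +
        φ * rightFactor b α y * rightFactor b α (P z)) := by
  have h := hP (toVec b φ) y z
  have hφ := X_pow_dvd_toSeries_toVec_sub b φ
  simp only [triple_bracket hn hF, mul_assoc, toVec_mul_congr hφ] at h ⊢
  rw [h, ← map_add, ← map_add]
  exact X_pow_dvd_toSeries_toVec_sub b _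

theorem rightFactor_basisVec_one (hn : 3 ≤ n) : rightFactor b α (basisVec b 1) = X := by
  rw [rightFactor_apply, secondCoord_apply, firstCoord_one b hn, toSeries_one b hn]
  simp

theorem rightFactor_basisVec_two (hn : 3 ≤ n) :
    rightFactor b α (basisVec b 2) = X * paramSeries α := by
  rw [rightFactor_apply, secondCoord_apply, firstCoord_basisVec b 0,
    toSeries_basisVec b (k := 0) (by omega)]
  simp

theorem coeff_zero_toSeries (v : L) :
    coeff 0 (toSeries b v) = firstCoord b v + secondCoord b v := by
  rw [secondCoord_apply]; ring

/-- A pre-derivation preserves the left annihilator of the triple products, which contains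
`e₁ - e₂` and on which the constant coefficient of the series vanishes. -/
theorem IsPreDerivation.coeff_zero_eq (hn : 4 ≤ n) (hF : IsFirstFamily br b α θ)
    (hP : IsPreDerivation br P) :
    coeff 0 (toSeries b (P (basisVec b 1))) = coeff 0 (toSeries b (P (basisVec b 2))) := by
  have h := hP (basisVec b 1 - basisVec b 2) (basisVec b 1) (basisVec b 1)
  simp only [triple_bracket (by omega) hF, toSeries_one_sub_two b (by omega : 3 ≤ n), zero_mul,
    map_zero, add_zero, rightFactor_basisVec_one (by omega : 3 ≤ n)] at h
  rw [eq_comm, toVec_eq_zero_iff, X_pow_dvd_iff] at h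
  have h2 := h 2 (by omega)
  rw [mul_assoc, ← pow_two, coeff_mul_X_pow' , if_pos le_rfl, Nat.sub_self, map_sub, map_sub,
    map_sub, sub_eq_zero] at h2
  exact h2

/-- The vectors `e₃, …, eₙ` annihilate `L` from the right, and for a vector with a nonzero `e₁`
coefficient the product `[[e₂, y], e₁]` has a nonzero term at `x ^ 2`. -/
theorem IsPreDerivation.firstCoord_toVec_X_mul (hn : 4 ≤ n) (hF : IsFirstFamily br b α θ)
    (hP : IsPreDerivation br P) (φ : ℂ⟦X⟧) : firstCoord b (P (toVec b (X * φ))) = 0 := by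
  have h0 : coeff 0 (toSeries b (toVec b (X * φ))) = 0 := by
    have h := X_pow_dvd_toSeries_toVec_sub b (X * φ)
    rw [X_pow_dvd_iff] at h
    have h' := h 0 (by omega)
    rwa [map_sub, sub_eq_zero, coeff_zero_X_mul] at h'
  have hr : rightFactor b α (toVec b (X * φ)) = 0 := by
    rw [rightFactor_apply, secondCoord_apply, h0, firstCoord_toVec]
    simp
  have h := hP (basisVec b 2) (toVec b (X * φ)) (basisVec b 1)
  simp only [triple_bracket (by omega) hF, hr, mul_zero, zero_mul, map_zero, add_zero, zero_add,
    rightFactor_basisVec_one (by omega : 3 ≤ n)] at h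
  have h2 := toSeries_basisVec b (k := 0) (by omega)
  rw [zero_add, pow_zero] at h2
  rw [h2, one_mul, rightFactor_apply, eq_comm, toVec_eq_zero_iff, X_pow_dvd_iff] at h
  have h3 := h 2 (by omega)
  rw [mul_right_comm, mul_assoc, ← mul_assoc, ← pow_two, coeff_X_pow_mul', if_pos le_rfl,
    Nat.sub_self, coeff_zero_eq_constantCoeff_apply] at h3
  have h4 := coeff_zero_paramSeries α
  rw [coeff_zero_eq_constantCoeff_apply] at h4
  simpa [h4] using h3

/-- Unless the odd part of the parameter series vanishes, a pre-derivation that is not nilpotent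
yields a nontrivial solution of the weight equation. -/
theorem IsPreDerivation.exists_weightDefect (hn : 5 ≤ n) (hF : IsFirstFamily br b α θ)
    (hP : IsPreDerivation br P) (hnil : ¬ IsNilpotent P)
    (hodd : ¬ X ^ (n - 3) ∣ oddPart (paramSeries α)) :
    ∃ a c : ℂ, ¬ (a = 0 ∧ c = 0) ∧ X ^ (n - 4) ∣ weightDefect a c (paramSeries α) := by
  set g := paramSeries α with hg
  set a := firstCoord b (P (basisVec b 1)) with ha
  set c := secondCoord b (P (basisVec b 1)) with hc
  set a' := firstCoord b (P (basisVec b 2)) with ha'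
  set c' := secondCoord b (P (basisVec b 2)) with hc'
  let D : ℂ⟦X⟧ →ₗ[ℂ] ℂ⟦X⟧ := toSeries b ∘ₗ P ∘ₗ toVec b
  have hD : ∀ φ, D φ = toSeries b (P (toVec b φ)) := fun φ => rfl
  have hn3 : 3 ≤ n := by omega
  have hr1 : rightFactor b α (P (basisVec b 1)) = X * (C a + C c * g) := rightFactor_apply b α _
  have hr2 : rightFactor b α (P (basisVec b 2)) = X * (C a' + C c' * g) :=
    rightFactor_apply b α _
  have h1 : ∀ φ, X ^ (n - 1) ∣ D (X ^ 2 * φ) -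
      (X ^ 2 * D φ + 2 * X ^ 2 * φ * (C a + C c * g)) := by
    intro φ
    have h := hP.series_relation hn3 hF φ (basisVec b 1) (basisVec b 1)
    rw [rightFactor_basisVec_one hn3, hr1] at h
    rw [hD, hD, show X ^ 2 * φ = φ * X * X by ring]
    convert h using 1
    ring
  have h2 : ∀ φ, X ^ (n - 1) ∣ D (X ^ 2 * (g * φ)) - (X ^ 2 * g * D φ +
      X ^ 2 * φ * g * (C a + C c * g) + X ^ 2 * φ * (C a' + C c' * g)) := by
    intro φ
    have h := hP.series_relation hn3 hF φ (basisVec b 1) (basisVec b 2)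
    rw [rightFactor_basisVec_one hn3, rightFactor_basisVec_two hn3, hr1, hr2] at h
    rw [hD, hD, show X ^ 2 * (g * φ) = φ * X * (X * g) by ring]
    convert h using 1
    ring
  obtain ⟨k1, k2⟩ := weight_relations (by omega) h1 h2
  rw [show n - 1 - 3 = n - 4 by omega] at k2
  have hg0 : constantCoeff g = 0 := by
    rw [← coeff_zero_eq_constantCoeff_apply, coeff_zero_paramSeries]
  have ha0 : a' = 0 := by
    have h := (X_pow_dvd_iff.1 k2) 0 (by omega)
    rw [coeff_zero_eq_constantCoeff_apply] at h
    simpa [hg0] using h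
  have hsum : a + c = c' := by
    have h := hP.coeff_zero_eq (by omega) hF
    rw [coeff_zero_toSeries, coeff_zero_toSeries, ← ha, ← hc, ← ha', ← hc', ha0, zero_add] at h
    exact h
  have hE : (C a + C c * g) * (X * d⁄dX ℂ g) + C (a - c') * g + C c * g ^ 2 - C a' =
      weightDefect a c g := by
    rw [← hsum, ha0, weightDefect]
    simp only [map_sub, map_add, map_zero]
    ring
  rw [hE] at k1 k2
  refine ⟨a, c, ?_, k2⟩
  rintro ⟨haz, hcz⟩
  apply hnil
  rw [haz, hcz] at k1 h1
  have hW : weightDefect 0 0 g = 0 := by simp [weightDefect]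
  rw [hW, mul_zero, add_zero] at k1
  have hV1 : toVec b 1 = basisVec b 2 := by simpa using toVec_X_pow b 0
  have hD1 : X ∣ D 1 := by
    rw [X_dvd_iff, ← coeff_zero_eq_constantCoeff_apply, hD, hV1, coeff_zero_toSeries, ← ha', ← hc',
      ha0, ← hsum, haz, hcz]
    simp
  have hraise : ∀ {k : ℕ}, k + 1 ≤ n - 1 → ∀ {φ : ℂ⟦X⟧}, X ^ k ∣ φ → X ^ (k + 1) ∣ D φ :=
    fun hk _ hφ => X_pow_succ_dvd_of_zero_weights (by omega) (by simpa using h1) hD1 k1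
      (by rwa [show n - 1 - 2 = n - 3 by omega]) hk hφ
  have hfirst : ∀ v, firstCoord b (P v) = 0 := by
    intro v
    have hV : ∀ φ, firstCoord b (P (toVec b φ)) = 0 := by
      intro φ
      obtain ⟨ψ, hψ⟩ := eq_C_add_X_mul φ
      rw [hψ, map_add, map_add, map_add, hP.firstCoord_toVec_X_mul (by omega) hF, add_zero,
        ← mul_one (C _), ← smul_eq_C_mul, map_smul, map_smul, map_smul, hV1, ← ha', ha0, smul_zero]
    rw [eq_smul_add_toVec b hn3 v]
    simp only [map_add, map_smul, map_sub, hV, ← ha, ← ha', haz, ha0, sub_zero, smul_zero,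
      add_zero]
  have hPv : ∀ v, P v = toVec b (toSeries b (P v)) := by
    intro v
    have h := eq_smul_add_toVec b hn3 (P v)
    rwa [hfirst, zero_smul, zero_add] at h
  have hpow : ∀ k ≤ n - 1, ∀ v, ∃ ψ, X ^ k ∣ ψ ∧ (P ^ (k + 1)) v = toVec b ψ := by
    intro k
    induction k with
    | zero => exact fun _ v => ⟨_, by simp, by rw [zero_add, pow_one]; exact hPv v⟩
    | succ k ih =>
      intro hk v
      obtain ⟨ψ, hψ, hv⟩ := ih (by omega) v
      exact ⟨D ψ, hraise hk hψ, by rw [pow_succ', Module.End.mul_apply, hv]; exact hPv _⟩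
  refine ⟨n - 1 + 1, LinearMap.ext fun v => ?_⟩
  obtain ⟨ψ, hψ, hv⟩ := hpow (n - 1) le_rfl v
  rw [hv, LinearMap.zero_apply, toVec_eq_zero_iff]
  exact hψ
end

/-! ### Translation into conditions on the parameters -/

section
open PowerSeries

theorem coeff_fussCatalanSeries_zero (r k : ℕ) : coeff k (fussCatalanSeries r 0) = 0 := by
  rw [fussCatalanSeries, coeff_mk]
  split_ifs with h
  · have : k / r ≠ 0 := by
      obtain ⟨t, rfl⟩ := h.1
      have h0 : r ≠ 0 := by rintro rfl; simp at h
      rw [Nat.mul_div_cancel_left _ (by omega)]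
      rintro rfl
      simp at h
    rw [zero_pow this, mul_zero]
  · rfl

/-- A nontrivial solution `(a, c)` of the weight equation forces `g` to be a Fuss–Catalan series:
the lowest term of `g`, in degree `r`, gives `c = a r`. If `g` vanishes to order `N`, take
`r = 2`. -/
theorem exists_coeff_eq_fussCatalanSeries {N : ℕ} (hN : 3 ≤ N) {a c : ℂ} {g : ℂ⟦X⟧}
    (h0 : coeff 0 g = 0) (hac : ¬ (a = 0 ∧ c = 0)) (hE : X ^ N ∣ weightDefect a c g) :
    ∃ r, 1 ≤ r ∧ r < N ∧ (r = 1 → coeff 1 g ≠ 0) ∧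
      ∀ k < N, coeff k g = coeff k (fussCatalanSeries r (coeff r g)) := by
  classical
  by_cases hz : ∀ k < N, coeff k g = 0
  · refine ⟨2, by omega, by omega, by omega, fun k hk => ?_⟩
    rw [hz k hk, hz 2 (by omega), coeff_fussCatalanSeries_zero]
  · push Not at hz
    have hlt : ∀ i < Nat.find hz, coeff i g = 0 := by
      intro i hi
      by_contra h
      exact Nat.find_min hz hi ⟨hi.trans (Nat.find_spec hz).1, h⟩
    obtain ⟨hrN, hrg⟩ := Nat.find_spec hz
    generalize Nat.find hz = r at hlt hrN hrg
    have hr : 1 ≤ r := by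
      rcases Nat.eq_zero_or_pos r with rfl | h
      · exact absurd h0 hrg
      · exact h
    have h1 := (X_pow_dvd_iff.1 hE) r hrN
    rw [coeff_weightDefect, Finset.sum_eq_zero, mul_zero, add_zero, mul_eq_zero,
      or_iff_left hrg, sub_eq_zero] at h1
    · subst h1
      have ha : a ≠ 0 := by rintro rfl; simp at hac
      exact ⟨r, hr, hrN, fun h => h ▸ hrg,
        coeff_eq_fussCatalanSeries_of_dvd_weightDefect hr ha hlt hE⟩
    · rintro ⟨i, j⟩ hij
      rw [Finset.HasAntidiagonal.mem_antidiagonal] at hij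
      simp only at hij ⊢
      rcases Nat.eq_zero_or_pos j with rfl | hj
      · rw [h0, mul_zero, mul_zero]
      · rw [hlt i (by omega), zero_mul]

theorem coeff_paramSeries_eq_iff {n r : ℕ} (hn : 5 ≤ n) (hr : 1 ≤ r) (α : ℕ → ℂ) (c : ℂ) :
    (∀ k < n - 4, coeff k (paramSeries α) = coeff k (fussCatalanSeries r c)) ↔
      (∀ t : ℕ, 1 ≤ t → t ≤ (n - 5) / r →
        α (r * t + 3) = (-1) ^ (t + 1) * catalanNumber (r + 1) t * c ^ t) ∧
      (∀ j : ℕ, 4 ≤ j → j ≤ n - 2 →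
        (∀ t : ℕ, 1 ≤ t → t ≤ (n - 5) / r → j ≠ r * t + 3) → α j = 0) := by
  have ht : ∀ t, t ≤ (n - 5) / r ↔ r * t ≤ n - 5 := fun t => by
    rw [Nat.le_div_iff_mul_le (by omega), mul_comm]
  simp only [ht]
  constructor
  · intro h
    refine ⟨fun t h1 h2 => ?_, fun j h1 h2 h3 => ?_⟩
    · have h4 := h (r * t) (by omega)
      rwa [coeff_paramSeries α (Nat.mul_pos hr h1), coeff_fussCatalanSeries_mul hr,
        if_neg (by omega), add_zero] at h4
    · obtain ⟨k, rfl⟩ := Nat.exists_eq_add_of_le' (show 3 ≤ j by omega)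
      have h4 := h k (by omega)
      rw [coeff_paramSeries α (by omega)] at h4
      rw [h4, coeff_fussCatalanSeries_of_not_dvd]
      rintro ⟨t, rfl⟩
      refine h3 t ?_ (by omega) rfl
      rcases Nat.eq_zero_or_pos t with rfl | h5
      · simp at h1
      · exact h5
  · rintro ⟨h1, h2⟩ k hk
    rcases Nat.eq_zero_or_pos k with rfl | hk0
    · rw [coeff_zero_paramSeries, coeff_zero_fussCatalanSeries]
    rw [coeff_paramSeries α hk0]
    by_cases hd : r ∣ k
    · obtain ⟨t, rfl⟩ := hd
      have ht0 : 1 ≤ t := Nat.pos_of_mul_pos_left hk0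
      rw [h1 t ht0 (by omega), coeff_fussCatalanSeries_mul hr, if_neg (by omega), add_zero]
    · rw [coeff_fussCatalanSeries_of_not_dvd c hd]
      refine h2 _ (by omega) (by omega) fun t _ _ h => hd ⟨t, ?_⟩
      omega

theorem coeff_paramSeries_eq_one_iff {n : ℕ} (hn : 5 ≤ n) (α : ℕ → ℂ) :
    (∀ k < n - 4, coeff k (paramSeries α) = coeff k (fussCatalanSeries 1 (α 4))) ↔
      ∀ k : ℕ, 5 ≤ k → k ≤ n - 2 →
        α k = (-1) ^ k * catalanNumber 2 (k - 3) * α 4 ^ (k - 3) := by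
  rw [coeff_paramSeries_eq_iff hn le_rfl]
  have hs : ∀ t : ℕ, (-1 : ℂ) ^ (t + 1) = (-1) ^ (t + 3) := fun t => by ring
  simp only [Nat.div_one, one_mul, Nat.reduceAdd]
  constructor
  · rintro ⟨h, -⟩ k h1 h2
    have h3 := h (k - 3) (by omega) (by omega)
    rwa [hs, Nat.sub_add_cancel (by omega)] at h3
  · intro h
    refine ⟨fun t h1 h2 => ?_, fun j h1 h2 h3 => ?_⟩
    · rw [hs]
      rcases h1.eq_or_lt with rfl | h1
      · norm_num [catalanNumber_one]
      · exact h (t + 3) (by omega) (by omega)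
    · exact absurd (Nat.sub_add_cancel (by omega)).symm (h3 (j - 3) (by omega) (by omega))

theorem X_pow_dvd_oddPart_paramSeries_iff {n : ℕ} (hn : 3 ≤ n) (hodd : Odd n) (α : ℕ → ℂ) :
    X ^ (n - 3) ∣ oddPart (paramSeries α) ↔
      ∀ i : ℕ, 2 ≤ i → i ≤ (n - 1) / 2 → α (2 * i) = 0 := by
  obtain ⟨m, rfl⟩ := hodd
  rw [X_pow_dvd_iff]
  constructor
  · intro h i h1 h2
    have h3 := h (2 * i - 3) (by omega)
    have ho : Odd (2 * i - 3) := ⟨i - 2, by omega⟩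
    rw [coeff_oddPart, if_pos ho, coeff_paramSeries α (by omega)] at h3
    rwa [Nat.sub_add_cancel (by omega)] at h3
  · intro h k hk
    rw [coeff_oddPart]
    split_ifs with ho
    · obtain ⟨j, rfl⟩ := ho
      rw [coeff_paramSeries α (by omega)]
      exact h (j + 2) (by omega) (by omega)
    · rfl
end

theorem theorem4p3 (n : ℕ) (hn : 3 ≤ n) (hodd : Odd n)
    {L : Type*} [AddCommGroup L] [Module ℂ L]
    (br : L →ₗ[ℂ] L →ₗ[ℂ] L) (hL : IsLeibnizBracket br)
    (b : Module.Basis (Fin n) ℂ L) (α : ℕ → ℂ) (θ : ℂ) (hF : IsFirstFamily br b α θ) :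
    ¬ IsStronglyNilpotent br ↔
      (α 4 ≠ 0 ∧ ∀ k : ℕ, 5 ≤ k → k ≤ n - 2 →
        α k = (-1) ^ k * catalanNumber 2 (k - 3) * α 4 ^ (k - 3)) ∨
      (∃ s : ℕ, 3 ≤ s ∧ s ≤ (n - 3) / 2 ∧
        (∀ t : ℕ, 1 ≤ t → t ≤ (n - 5) / (2 * s - 3) →
          α ((2 * s - 3) * t + 3) =
            (-1) ^ (t + 1) * catalanNumber (2 * s - 2) t * α (2 * s) ^ t) ∧
        (∀ j : ℕ, 4 ≤ j → j ≤ n - 2 →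
          (∀ t : ℕ, 1 ≤ t → t ≤ (n - 5) / (2 * s - 3) → j ≠ (2 * s - 3) * t + 3) → α j = 0)) ∨
      (∀ i : ℕ, 2 ≤ i → i ≤ (n - 1) / 2 → α (2 * i) = 0) ∨
      (∃ s : ℕ, 2 ≤ s ∧ s ≤ (n - 3) / 2 ∧
        (∀ t : ℕ, 1 ≤ t → t ≤ (n - 5) / (2 * s - 2) →
          α ((2 * s - 2) * t + 3) =
            (-1) ^ (t + 1) * catalanNumber (2 * s - 1) t * α (2 * s + 1) ^ t) ∧
        (∀ j : ℕ, 4 ≤ j → j ≤ n - 2 →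
          (∀ t : ℕ, 1 ≤ t → t ≤ (n - 5) / (2 * s - 2) → j ≠ (2 * s - 2) * t + 3) → α j = 0)) := by
  rw [← X_pow_dvd_oddPart_paramSeries_iff hn hodd]
  by_cases ho : PowerSeries.X ^ (n - 3) ∣ oddPart (paramSeries α)
  · exact iff_of_true (not_isStronglyNilpotent_of_oddPart hn hF ho) (Or.inr (Or.inr (Or.inl ho)))
  have hn5 : 5 ≤ n := by
    by_contra! h
    obtain rfl : n = 3 := by
      obtain ⟨m, rfl⟩ := hodd
      omega
    exact ho (one_dvd _)
  have hpat : ∀ r c, 1 ≤ r → (∀ k < n - 4, PowerSeries.coeff k (paramSeries α) =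
      PowerSeries.coeff k (fussCatalanSeries r c)) → ¬ IsStronglyNilpotent br := fun r c hr h =>
    not_isStronglyNilpotent_of_weightDefect hn5 hF one_ne_zero (dvd_weightDefect_of_coeff_eq hr h)
  constructor
  · intro h
    unfold IsStronglyNilpotent at h
    push Not at h
    obtain ⟨P, hP, hnil⟩ := h
    obtain ⟨a, c, hac, hE⟩ := hP.exists_weightDefect hn5 hF hnil ho
    by_cases h5 : n = 5
    · subst h5
      refine Or.inl ⟨fun h4 => ho ?_, fun k h1 h2 => by omega⟩
      rw [X_pow_dvd_oddPart_paramSeries_iff hn hodd]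
      intro i h1 h2
      obtain rfl : i = 2 := by omega
      exact h4
    have hn7 : 7 ≤ n := by
      obtain ⟨m, rfl⟩ := hodd
      omega
    obtain ⟨r, hr, hrn, hr1, hg⟩ := exists_coeff_eq_fussCatalanSeries (by omega)
      (coeff_zero_paramSeries α) hac hE
    rw [coeff_paramSeries α hr] at hg
    by_cases h1 : r = 1
    · subst h1
      have h4 := hr1 rfl
      rw [coeff_paramSeries α le_rfl] at h4
      exact Or.inl ⟨h4, (coeff_paramSeries_eq_one_iff hn5 α).1 hg⟩
    rw [coeff_paramSeries_eq_iff hn5 hr] at hg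
    rcases Nat.even_or_odd r with he | he
    · obtain ⟨s, rfl⟩ := he
      refine Or.inr (Or.inr (Or.inr ⟨s + 1, by omega, by omega, ?_⟩))
      rw [show 2 * (s + 1) - 2 = s + s by omega, show 2 * (s + 1) - 1 = s + s + 1 by omega,
        show 2 * (s + 1) + 1 = s + s + 3 by omega]
      exact hg
    · obtain ⟨s, rfl⟩ := he
      refine Or.inr (Or.inl ⟨s + 2, by omega, ?_, ?_⟩)
      · obtain ⟨m, rfl⟩ := hodd
        omega
      rw [show 2 * (s + 2) - 3 = 2 * s + 1 by omega, show 2 * (s + 2) - 2 = 2 * s + 1 + 1 by omega,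
        show 2 * (s + 2) = 2 * s + 1 + 3 by omega]
      exact hg
  · rintro (⟨-, h⟩ | ⟨s, hs, -, h⟩ | h | ⟨s, hs, -, h⟩)
    · exact hpat 1 _ le_rfl ((coeff_paramSeries_eq_one_iff hn5 α).2 h)
    · rw [show 2 * s - 2 = 2 * s - 3 + 1 by omega] at h
      exact hpat (2 * s - 3) _ (by omega) ((coeff_paramSeries_eq_iff hn5 (by omega) α _).2 h)
    · exact absurd h ho
    · rw [show 2 * s - 1 = 2 * s - 2 + 1 by omega] at h
      exact hpat (2 * s - 2) _ (by omega) ((coeff_paramSeries_eq_iff hn5 (by omega) α _).2 h)
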